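/- In (non-metric) facility location there are $m \ge 1$ facilities, facility $f$ having opening cost $c_f \in [0,\infty)$, and $n$ clients, client $v$ having connection cost $c_{fv} \in [0,\infty]$ to facility $f$; no triangle inequality is assumed. A solution opens a set $S$ of facilities and connects every client to one facility in $S$; its cost is the sum of the opening costs of the facilities in $S$ and of the connection costs of all clients, and $\mathrm{OPT}$ denotes the least cost of a solution. In the random-order online version the facilities and their opening costs are known in advance. An adversary fixes the $n$ clients, which then arrive one by one in uniformly random order; the connection costs of a client are revealed when it arrives. On each arrival the algorithm may open further facilities and must connect the arriving client to an open facility, and these decisions are irrevocable. The algorithm may use randomness and knows neither the future clients nor their number $n$. Theorem. There are an absolute constant $C > 0$ and a randomized online algorithm such that for every number $m \ge 1$ of facilities, all opening costs, and all choices of $n$ clients with $mn \ge 2$, the expected total cost of the algorithm, over the random order and its own randomness, is at most $C \log(mn) \cdot \mathrm{OPT}$. That is, there is an $O(\log mn)$-competitive randomized algorithm for random-order non-metric facility location. -/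

import Mathlib

open scoped NNReal ENNReal

namespace FacilityLocation

/-- A client, given by its vector of connection costs to the facilities. The costs are arbitrary
(no triangle inequality) and may be infinite, so that set cover is a special case. -/
abbrev Client (F : Type*) := F → ℝ≥0∞

/-- The irrevocable decision taken when a client arrives: the set of facilities that are opened
now, and the facility to which the client is connected. -/
abbrev Decision (F : Type*) := Finset F × F

/-- What has happened so far, most recent round first: the clients that have arrived, each with
the decision that was taken on its arrival. -/
abbrev History (F : Type*) := List (Client F × Decision F)

/-- The facilities opened during a history. -/
def openFacilities {F : Type*} [DecidableEq F] : History F → Finset F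
  | [] => ∅
  | (_, d) :: h => d.1 ∪ openFacilities h

/-- The total cost of a history: the opening costs of all opened facilities (each paid once), plus
for every client the cost of its connection. -/
noncomputable def historyCost {F : Type*} [DecidableEq F] (c : F → ℝ≥0) (h : History F) : ℝ≥0∞ :=
  (∑ f ∈ openFacilities h, (c f : ℝ≥0∞)) + (h.map fun p => p.1 p.2.2).sum

/-- A randomized online algorithm for facility location on the facility set `F`. On the arrival of
a client it draws its decision from a distribution that depends only on the past (the earlier
clients and its own earlier decisions) and on the arriving client; in particular it knows neither
the future clients nor their number. The arriving client has to be connected to a facility that is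
already open or is opened in this round. -/
structure OnlineAlgorithm (F : Type*) [DecidableEq F] where
  act : History F → Client F → PMF (Decision F)
  feasible : ∀ (h : History F) (v : Client F), ∀ d ∈ (act h v).support,
    d.2 ∈ d.1 ∪ openFacilities h

/-- The law of the final history when, after the history `h`, the clients of a list arrive in the
order of the list. -/
noncomputable def OnlineAlgorithm.run {F : Type*} [DecidableEq F] (A : OnlineAlgorithm F) :
    History F → List (Client F) → PMF (History F)
  | h, [] => PMF.pure h
  | h, v :: vs => (A.act h v).bind fun d => A.run ((v, d) :: h) vs

/-- The expected cost of an algorithm, over its internal randomness, on a fixed arrival sequence. -/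
noncomputable def OnlineAlgorithm.expectedCost {F : Type*} [DecidableEq F] (A : OnlineAlgorithm F)
    (c : F → ℝ≥0) (vs : List (Client F)) : ℝ≥0∞ :=
  ∑' h : History F, A.run [] vs h * historyCost c h

/-- The expected cost of an algorithm when the clients arrive in uniformly random order; the
expectation is over the order and over the internal randomness of the algorithm. -/
noncomputable def OnlineAlgorithm.randomOrderCost {F : Type*} [DecidableEq F]
    (A : OnlineAlgorithm F) (c : F → ℝ≥0) {n : ℕ} (clients : Fin n → Client F) : ℝ≥0∞ :=
  (∑ σ : Equiv.Perm (Fin n), A.expectedCost c (List.ofFn fun i => clients (σ i))) /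
    (n.factorial : ℝ≥0∞)

/-- The offline optimum: the least cost of a set `S` of opened facilities together with an
assignment `g` of every client to a facility in `S`. -/
noncomputable def opt {F : Type*} (c : F → ℝ≥0) {n : ℕ} (clients : Fin n → Client F) : ℝ≥0∞ :=
  ⨅ (S : Finset F) (g : Fin n → F) (_ : ∀ i, g i ∈ S),
    (∑ f ∈ S, (c f : ℝ≥0∞)) + ∑ i, clients i (g i)

end FacilityLocation

/-! The algorithm is of learn-or-cover type. It keeps a guess b for the optimum, renewed to twice
the optimum of the clients seen once that optimum exceeds b, and multiplicative weights with
normalization p. A client v of current service cost κ is served for κ. Unless v renews the guess,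
each f is also opened with probability min(1, κ p_f / c_f), at total expected cost at most κ. Let X
be the cover b Σ p_f / c_f over facilities near v, truncated at 1.

Learning: if the cover is below 1, the facilities near v gain weight. An offline solution contains
one of them or pays at least κ/2 for v itself, so the quantities κ(1/2 - X) add up to at most b(log
m + 1) between renewals (`regret_le`).

Covering: sampling halves the service cost of a remaining client u with probability at least κ X_u /
(2b) (`sum_subsetWeight_mul_pending_le`). With K and Q the sums of κ_u and κ_u X_u over the
remaining clients compatible with b, the expected value of b log(1 + K/b) drops by at least
(κ/4)(b+Q)/(b+K).

In `potential` these two quantities have factors 4 and 16. The spending 2κ cancels, leaving the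
drift 4κX - 4κ(b+Q)/(b+K). This may be positive for a particular v, but its sum over the remaining
clients is not (`sum_drift_nonpos`); only here does the random order enter. Renewals are paid by the
term D(4V - 2b), because b more than doubles (`expectedStep_le_of_restart`). The initial potential
is 4D·OPT with D = O(log mn); n occurs in the analysis only. -/

namespace FacilityLocation

set_option linter.unusedSectionVars false

/-! ### Random subsets with independent members -/

section IndependentSubset

variable {F : Type*} [Fintype F] [DecidableEq F]

/-- The probability of the set `S` when every `f` belongs to it independently with
probability `q f`. -/
noncomputable def subsetWeight (q : F → ℝ) (S : Finset F) : ℝ :=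
  (∏ f ∈ S, q f) * ∏ f ∈ Finset.univ \ S, (1 - q f)

lemma subsetWeight_nonneg {q : F → ℝ} (h0 : ∀ f, 0 ≤ q f) (h1 : ∀ f, q f ≤ 1) (S : Finset F) :
    0 ≤ subsetWeight q S :=
  mul_nonneg (Finset.prod_nonneg fun f _ => h0 f)
    (Finset.prod_nonneg fun f _ => sub_nonneg.2 (h1 f))

/-- Expand the product of a_f + (1 - q_f), where a_f is q_f off N and 0 on N. Taking N empty gives
the total mass, N = {f} the marginals. -/
lemma sum_subsetWeight_of_disjoint (q : F → ℝ) (N : Finset F) :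
    ∑ S : Finset F, (if Disjoint S N then subsetWeight q S else 0) = ∏ f ∈ N, (1 - q f) := by
  have h := Finset.prod_add (fun f => if f ∈ N then 0 else q f) (fun f => 1 - q f)
    (Finset.univ : Finset F)
  rw [Finset.powerset_univ] at h
  have h2 : ∏ f : F, ((if f ∈ N then 0 else q f) + (1 - q f)) = ∏ f ∈ N, (1 - q f) := by
    rw [← Finset.prod_subset (Finset.subset_univ N)]
    · exact Finset.prod_congr rfl fun f hf => by simp [hf]
    · intro f _ hf
      simp [hf]
  rw [← h2, h]
  refine Finset.sum_congr rfl fun S _ => ?_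
  split_ifs with hS
  · unfold subsetWeight
    congr 1
    exact Finset.prod_congr rfl fun f hf => by simp [Finset.disjoint_left.1 hS hf]
  · obtain ⟨f, hfS, hfN⟩ := Finset.not_disjoint_iff.1 hS
    rw [Finset.prod_eq_zero hfS (by simp [hfN]), zero_mul]

lemma sum_subsetWeight (q : F → ℝ) : ∑ S : Finset F, subsetWeight q S = 1 := by
  simpa using sum_subsetWeight_of_disjoint q ∅

lemma sum_subsetWeight_mem (q : F → ℝ) (f : F) :
    ∑ S : Finset F, (if f ∈ S then subsetWeight q S else 0) = q f := by
  have h := sum_subsetWeight_of_disjoint q {f}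
  have h2 : ∑ S : Finset F, ((if f ∈ S then subsetWeight q S else 0) +
      (if Disjoint S {f} then subsetWeight q S else 0)) = 1 := by
    rw [← sum_subsetWeight q]
    refine Finset.sum_congr rfl fun S _ => ?_
    by_cases hf : f ∈ S <;> simp [hf]
  rw [Finset.sum_add_distrib, h] at h2
  simp at h2
  linarith

lemma sum_subsetWeight_mul_sum (q a : F → ℝ) :
    ∑ S : Finset F, subsetWeight q S * ∑ f ∈ S, a f = ∑ f, q f * a f := by
  have h : ∀ S : Finset F, subsetWeight q S * ∑ f ∈ S, a f =
      ∑ f, (if f ∈ S then subsetWeight q S else 0) * a f := by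
    intro S
    rw [Finset.mul_sum, ← Finset.sum_subset (Finset.subset_univ S)]
    · exact Finset.sum_congr rfl fun f hf => by simp [hf]
    · intro f _ hf
      simp [hf]
  simp_rw [h]
  rw [Finset.sum_comm]
  exact Finset.sum_congr rfl fun f _ => by rw [← Finset.sum_mul, sum_subsetWeight_mem]

/-- The law of a random subset with independent members. -/
noncomputable def subsetPMF (q : F → ℝ) (h0 : ∀ f, 0 ≤ q f) (h1 : ∀ f, q f ≤ 1) :
    PMF (Finset F) :=
  PMF.ofFintype (fun S => ENNReal.ofReal (subsetWeight q S)) <| by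
    rw [← ENNReal.ofReal_sum_of_nonneg fun S _ => subsetWeight_nonneg h0 h1 S, sum_subsetWeight,
      ENNReal.ofReal_one]

/-- A random subset meets `N` with probability at least half of its expected number of elements
in `N`, truncated at `1`. -/
lemma prod_one_sub_le {q : F → ℝ} (h1 : ∀ f, q f ≤ 1) (N : Finset F) {s : ℝ}
    (hs0 : 0 ≤ s) (hs1 : s ≤ 1) (hs : s ≤ ∑ f ∈ N, q f) :
    ∏ f ∈ N, (1 - q f) ≤ 1 - s / 2 := by
  calc ∏ f ∈ N, (1 - q f) ≤ ∏ f ∈ N, Real.exp (-q f) :=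
        Finset.prod_le_prod (fun f _ => sub_nonneg.2 (h1 f)) fun f _ => by
          have := Real.add_one_le_exp (-q f); linarith
    _ = Real.exp (-∑ f ∈ N, q f) := by rw [← Real.exp_sum, Finset.sum_neg_distrib]
    _ ≤ Real.exp (-s) := Real.exp_le_exp.2 (neg_le_neg hs)
    _ ≤ 1 / (1 + s) := by
        rw [Real.exp_neg, inv_eq_one_div]
        have := Real.add_one_le_exp s
        exact one_div_le_one_div_of_le (by linarith) (by linarith)
    -- (1 + s)(1 - s/2) = 1 + s(1 - s)/2, which is at least 1 on [0,1].
    _ ≤ 1 - s / 2 := by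
        rw [div_le_iff₀ (by linarith)]
        nlinarith

end IndependentSubset

/-! ### Offline costs -/

section Offline

variable {F : Type*} [Fintype F] [DecidableEq F] (c : F → ℝ≥0)

/-- The least cost of serving a client when the facilities in `O` are open. -/
noncomputable def serviceCost (O : Finset F) (v : Client F) : ℝ≥0∞ :=
  Finset.univ.inf fun f => (if f ∈ O then 0 else (c f : ℝ≥0∞)) + v f

lemma serviceCost_le (O : Finset F) (v : Client F) (f : F) :
    serviceCost c O v ≤ (if f ∈ O then 0 else (c f : ℝ≥0∞)) + v f :=
  Finset.inf_le (Finset.mem_univ f)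

lemma serviceCost_le_of_mem {O : Finset F} (v : Client F) {f : F} (hf : f ∈ O) :
    serviceCost c O v ≤ v f := by
  simpa [hf] using serviceCost_le c O v f

lemma serviceCost_anti {O O' : Finset F} (h : O ⊆ O') (v : Client F) :
    serviceCost c O' v ≤ serviceCost c O v := by
  refine Finset.le_inf fun f _ => (serviceCost_le c O' v f).trans ?_
  gcongr
  by_cases hf : f ∈ O
  · simp [hf, h hf]
  · by_cases hf' : f ∈ O' <;> simp [hf, hf']

lemma exists_serviceCost_eq [Nonempty F] (O : Finset F) (v : Client F) :
    ∃ f, serviceCost c O v = (if f ∈ O then 0 else (c f : ℝ≥0∞)) + v f := by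
  obtain ⟨f, -, hf⟩ := Finset.exists_mem_eq_inf (Finset.univ : Finset F) Finset.univ_nonempty
    fun f => (if f ∈ O then 0 else (c f : ℝ≥0∞)) + v f
  exact ⟨f, hf⟩

/-- A facility through which a client is served at least cost. -/
noncomputable def cheapest [Nonempty F] (O : Finset F) (v : Client F) : F :=
  (exists_serviceCost_eq c O v).choose

lemma serviceCost_eq_cheapest [Nonempty F] (O : Finset F) (v : Client F) :
    serviceCost c O v =
      (if cheapest c O v ∈ O then 0 else (c (cheapest c O v) : ℝ≥0∞)) + v (cheapest c O v) :=
  (exists_serviceCost_eq c O v).choose_spec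

/-- The cost of serving a list of clients by the facilities in `S`. -/
noncomputable def offlineCost (S : Finset F) (l : List (Client F)) : ℝ≥0∞ :=
  (∑ f ∈ S, (c f : ℝ≥0∞)) + (l.map fun v => S.inf v).sum

/-- The optimal cost of serving a list of clients. -/
noncomputable def offlineOpt (l : List (Client F)) : ℝ≥0∞ := ⨅ S : Finset F, offlineCost c S l

lemma offlineCost_cons (S : Finset F) (v : Client F) (l : List (Client F)) :
    offlineCost c S (v :: l) = S.inf v + offlineCost c S l := by
  simp only [offlineCost, List.map_cons, List.sum_cons]
  ring

lemma offlineOpt_le_cons (v : Client F) (l : List (Client F)) :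
    offlineOpt c l ≤ offlineOpt c (v :: l) :=
  iInf_mono fun S => by rw [offlineCost_cons]; exact le_add_self

lemma exists_offlineOpt_eq (l : List (Client F)) : ∃ S, offlineCost c S l = offlineOpt c l :=
  exists_eq_ciInf_of_finite

/-- Any solution of finite cost pays for opening the facility that serves v and for the connection
to it. Hence an arrival that does not renew the guess has service cost at most the guess. -/
lemma serviceCost_empty_le_offlineOpt (v : Client F) (l : List (Client F)) :
    serviceCost c ∅ v ≤ offlineOpt c (v :: l) := by
  refine le_iInf fun S => ?_
  rw [offlineCost_cons]
  rcases S.eq_empty_or_nonempty with rfl | hS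
  · simp
  · obtain ⟨f, hf, hfv⟩ := Finset.exists_mem_eq_inf S hS v
    rw [hfv, add_comm]
    refine (serviceCost_le c ∅ v f).trans ?_
    simp only [Finset.notMem_empty, if_false]
    gcongr
    exact (Finset.single_le_sum (f := fun f => (c f : ℝ≥0∞)) (fun _ _ => zero_le) hf).trans
      le_self_add

lemma serviceCost_le_offlineOpt (O : Finset F) (v : Client F) (l : List (Client F)) :
    serviceCost c O v ≤ offlineOpt c (v :: l) :=
  (serviceCost_anti c (Finset.empty_subset O) v).trans (serviceCost_empty_le_offlineOpt c v l)

lemma offlineOpt_ofFn_le_opt {n : ℕ} (clients : Fin n → Client F) :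
    offlineOpt c (List.ofFn clients) ≤ opt c clients := by
  refine le_iInf fun S => le_iInf fun g => le_iInf fun hg => ?_
  refine (iInf_le _ S).trans ?_
  unfold offlineCost
  gcongr
  rw [List.map_ofFn, List.sum_ofFn]
  exact Finset.sum_le_sum fun i _ => Finset.inf_le (hg i)

end Offline

/-! ### The algorithm -/

section Algorithm

variable {F : Type*} [Fintype F] [DecidableEq F] (c : F → ℝ≥0)

/-- The clients of a history. -/
def seen (h : History F) : List (Client F) := h.map Prod.fst

/-- What the algorithm remembers: its guess for the optimal cost, the multiplicative weights of
the facilities, and the accumulated regret since the guess was last changed. -/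
structure LearnState (F : Type*) where
  budget : ℝ≥0
  weight : F → ℝ
  regret : ℝ

/-- The normalized weights. -/
noncomputable def LearnState.prob (s : LearnState F) (f : F) : ℝ :=
  s.weight f / ∑ g, s.weight g

/-- The service cost as a real number. -/
noncomputable def kappa (O : Finset F) (v : Client F) : ℝ := (serviceCost c O v).toReal

/-- The facilities whose connection cost to `v` is at most half of the current service cost. -/
noncomputable def near (O : Finset F) (v : Client F) : Finset F :=
  Finset.univ.filter fun f => 2 * v f ≤ serviceCost c O v

/-- The fractional extent to which the weights open facilities near `v`. -/
noncomputable def LearnState.cover (s : LearnState F) (O : Finset F) (v : Client F) : ℝ :=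
  ∑ f ∈ near c O v, s.budget * (s.prob f / c f)

/-- The exponent by which the weight of a facility grows on the arrival of `v`. -/
noncomputable def LearnState.boost (s : LearnState F) (O : Finset F) (v : Client F) (f : F) : ℝ :=
  if f ∈ near c O v ∧ s.cover c O v < 1 then kappa c O v / (2 * c f) else 0

/-- The multiplicative weights update on the arrival of `v`. -/
noncomputable def LearnState.update (s : LearnState F) (O : Finset F) (v : Client F) :
    LearnState F where
  budget := s.budget
  weight f := s.weight f * Real.exp (s.boost c O v f)
  regret := s.regret + kappa c O v * (1 / 2 - min (s.cover c O v) 1)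

/-- The state after a history. The guess is renewed when the optimal cost of the clients seen so
far exceeds it. -/
noncomputable def learnState : History F → LearnState F
  -- With guess 0, the first client that makes the optimum positive renews it; until then all
  -- service costs are 0.
  | [] => ⟨0, 1, 0⟩
  | (v, _) :: h =>
    if offlineOpt c (v :: seen h) ≤ (learnState h).budget then
      (learnState h).update c (openFacilities h) v
    else ⟨2 * (offlineOpt c (v :: seen h)).toNNReal, 1, 0⟩

/-- The probability with which a facility is opened on the arrival of `v`. -/
noncomputable def openProb (h : History F) (v : Client F) (f : F) : ℝ :=
  if offlineOpt c (v :: seen h) ≤ (learnState c h).budget then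
    min 1 (kappa c (openFacilities h) v * ((learnState c h).prob f / c f))
  else 0

/-! ### Weights and opening probabilities are well formed -/

lemma kappa_nonneg (O : Finset F) (v : Client F) : 0 ≤ kappa c O v := ENNReal.toReal_nonneg

lemma weight_pos (h : History F) (f : F) : 1 ≤ (learnState c h).weight f := by
  induction h with
  | nil => simp [learnState]
  | cons p h ih =>
    obtain ⟨v, d⟩ := p
    rw [learnState]
    split_ifs
    · refine one_le_mul_of_one_le_of_one_le ih (Real.one_le_exp ?_)
      unfold LearnState.boost
      split_ifs
      · exact div_nonneg (kappa_nonneg c _ _) (by positivity)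
      · exact le_rfl
    · simp

lemma card_le_sum_weight (h : History F) :
    (Fintype.card F : ℝ) ≤ ∑ f, (learnState c h).weight f := by
  simpa using Finset.sum_le_sum fun f (_ : f ∈ Finset.univ) => weight_pos c h f

lemma sum_weight_pos [Nonempty F] (h : History F) : 0 < ∑ f, (learnState c h).weight f :=
  lt_of_lt_of_le (by exact_mod_cast Fintype.card_pos) (card_le_sum_weight c h)

lemma one_le_sum_weight [Nonempty F] (h : History F) : 1 ≤ ∑ f, (learnState c h).weight f :=
  le_trans (by exact_mod_cast Fintype.card_pos (α := F)) (card_le_sum_weight c h)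

lemma prob_nonneg (h : History F) (f : F) : 0 ≤ (learnState c h).prob f :=
  div_nonneg (zero_le_one.trans (weight_pos c h f))
    (Finset.sum_nonneg fun g _ => zero_le_one.trans (weight_pos c h g))

lemma sum_prob [Nonempty F] (h : History F) : ∑ f, (learnState c h).prob f = 1 := by
  unfold LearnState.prob
  rw [← Finset.sum_div, div_self (sum_weight_pos c h).ne']

lemma openProb_nonneg (h : History F) (v : Client F) (f : F) : 0 ≤ openProb c h v f := by
  unfold openProb
  split_ifs
  · exact le_min zero_le_one
      (mul_nonneg (kappa_nonneg c _ _) (div_nonneg (prob_nonneg c h f) (by positivity)))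
  · exact le_rfl

lemma openProb_le_one (h : History F) (v : Client F) (f : F) : openProb c h v f ≤ 1 := by
  unfold openProb
  split_ifs
  · exact min_le_left _ _
  · exact zero_le_one

/-- The decision that opens the facilities in `S` and serves `v` as cheaply as possible. -/
noncomputable def serve [Nonempty F] (h : History F) (v : Client F) (S : Finset F) : Decision F :=
  (insert (cheapest c (openFacilities h) v) S, cheapest c (openFacilities h) v)

/-- Learn or cover: on the arrival of a client, facilities are opened at random according to the
multiplicative weights, and the client is served at the least possible cost. -/
noncomputable def learnOrCover [Nonempty F] : OnlineAlgorithm F where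
  act h v := (subsetPMF (openProb c h v) (openProb_nonneg c h v) (openProb_le_one c h v)).map
    (serve c h v)
  feasible h v d hd := by
    obtain ⟨S, -, rfl⟩ := (PMF.mem_support_map_iff _ _ _).1 hd
    simp [serve]

/-! ### The regret bound -/

lemma cover_nonneg (h : History F) (O : Finset F) (v : Client F) :
    0 ≤ (learnState c h).cover c O v :=
  Finset.sum_nonneg fun f _ =>
    mul_nonneg (by positivity) (div_nonneg (prob_nonneg c h f) (by positivity))

/-- Serving v through f costs at most c_f plus half of the service cost. This keeps the exponents of
the update at most 1 and makes division by c_f = 0 harmless, since then the service cost is 0. -/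
lemma kappa_le_of_mem_near {O : Finset F} {v : Client F} {f : F} (hf : f ∈ near c O v)
    (hfin : serviceCost c O v ≠ ∞) : kappa c O v ≤ 2 * c f := by
  have h1 : 2 * v f ≤ serviceCost c O v := by simpa [near] using hf
  have h2 : serviceCost c O v ≤ c f + v f := (serviceCost_le c O v f).trans <| by
    gcongr
    split_ifs <;> simp
  have hv : v f ≠ ∞ := by
    intro hv
    rw [hv, ENNReal.mul_top (by norm_num), top_le_iff] at h1
    exact hfin h1
  have h1' := ENNReal.toReal_mono hfin h1
  have h2' := ENNReal.toReal_mono (by simp [hv]) h2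
  rw [ENNReal.toReal_add (by simp) hv, ENNReal.coe_toReal] at h2'
  rw [ENNReal.toReal_mul, ENNReal.toReal_ofNat] at h1'
  unfold kappa
  linarith

lemma boost_nonneg (s : LearnState F) (O : Finset F) (v : Client F) (f : F) :
    0 ≤ s.boost c O v f := by
  unfold LearnState.boost
  split_ifs
  · exact div_nonneg (kappa_nonneg c _ _) (by positivity)
  · exact le_rfl

lemma exp_le_one_add_two_mul {x : ℝ} (h0 : 0 ≤ x) (h1 : x ≤ 1) : Real.exp x ≤ 1 + 2 * x := by
  have h := Real.abs_exp_sub_one_le (x := x) (by rwa [abs_of_nonneg h0])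
  rw [abs_of_nonneg h0] at h
  linarith [le_abs_self (Real.exp x - 1)]

/-- One multiplicative weights step: growth of the total weight. -/
lemma budget_mul_log_sum_update_le [Nonempty F] (h : History F) {O : Finset F} {v : Client F}
    (hfin : serviceCost c O v ≠ ∞) (hX : (learnState c h).cover c O v < 1) :
    (learnState c h).budget * Real.log (∑ f, ((learnState c h).update c O v).weight f) ≤
      (learnState c h).budget * Real.log (∑ f, (learnState c h).weight f) +
        kappa c O v * (learnState c h).cover c O v := by
  set s := learnState c h with hs
  have hW : 0 < ∑ f, s.weight f := sum_weight_pos c h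
  have hterm : ∀ f, (s.update c O v).weight f ≤
      s.weight f + (if f ∈ near c O v then s.weight f * (kappa c O v / c f) else 0) := by
    intro f
    have hw : 0 ≤ s.weight f := zero_le_one.trans (weight_pos c h f)
    by_cases hf : f ∈ near c O v
    · have hk := kappa_le_of_mem_near c hf hfin
      have hb : s.boost c O v f = kappa c O v / (2 * c f) := by simp [LearnState.boost, hf, hX]
      have hb1 : s.boost c O v f ≤ 1 := by
        rw [hb]; exact div_le_one_of_le₀ hk (by positivity)
      have he := exp_le_one_add_two_mul (boost_nonneg c s O v f) hb1
      -- The 2 in the denominator of the exponent absorbs the one in e^x ≤ 1 + 2x.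
      have h2 : 2 * s.boost c O v f = kappa c O v / c f := by
        rw [hb, mul_div_assoc', mul_div_mul_left _ _ two_ne_zero]
      rw [h2] at he
      simp only [hf, if_true]
      calc s.weight f * Real.exp (s.boost c O v f) ≤ s.weight f * (1 + kappa c O v / c f) := by
            gcongr
        _ = _ := by ring
    · simp [LearnState.update, LearnState.boost, hf]
  have hsum : ∑ f, (s.update c O v).weight f ≤
      (∑ f, s.weight f) + ∑ f ∈ near c O v, s.weight f * (kappa c O v / c f) := by
    refine (Finset.sum_le_sum fun f _ => hterm f).trans_eq ?_
    rw [Finset.sum_add_distrib, Finset.sum_ite_mem, Finset.univ_inter]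
  set W := ∑ f, s.weight f with hWdef
  have hpos : 0 < ∑ f, (s.update c O v).weight f :=
    Finset.sum_pos (fun f _ => mul_pos (zero_lt_one.trans_le (weight_pos c h f))
      (Real.exp_pos _)) Finset.univ_nonempty
  have hlog : Real.log (∑ f, (s.update c O v).weight f) ≤
      Real.log W + (∑ f ∈ near c O v, s.weight f * (kappa c O v / c f)) / W := by
    have h1 := Real.log_le_sub_one_of_pos (div_pos hpos hW)
    rw [Real.log_div hpos.ne' hW.ne'] at h1
    have h2 : (∑ f, (s.update c O v).weight f) / W ≤
        1 + (∑ f ∈ near c O v, s.weight f * (kappa c O v / c f)) / W := by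
      rw [div_le_iff₀ hW, add_mul, div_mul_cancel₀ _ hW.ne', one_mul]
      exact hsum
    linarith
  have hcov : s.budget * ((∑ f ∈ near c O v, s.weight f * (kappa c O v / c f)) / W) =
      kappa c O v * s.cover c O v := by
    rw [LearnState.cover, Finset.sum_div, Finset.mul_sum, Finset.mul_sum]
    refine Finset.sum_congr rfl fun f _ => ?_
    rw [LearnState.prob]
    ring
  rw [← hcov, ← mul_add]
  gcongr

/-- The connection cost to `S` of a list of clients. -/
noncomputable def connCost (S : Finset F) (l : List (Client F)) : ℝ≥0∞ :=
  (l.map fun v => S.inf v).sum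

/-- One multiplicative weights step: growth of the weights of an offline solution. -/
lemma half_kappa_le (s : LearnState F) {O : Finset F} {v : Client F} {S : Finset F}
    (hfin : serviceCost c O v ≠ ∞) (hS : S.inf v ≠ ∞) (hX : s.cover c O v < 1) :
    kappa c O v / 2 ≤ ∑ f ∈ S, c f * s.boost c O v f + (S.inf v).toReal := by
  have hsum0 : ∀ f ∈ S, (0 : ℝ) ≤ c f * s.boost c O v f := fun f _ =>
    mul_nonneg (by positivity) (boost_nonneg c s O v f)
  -- One near facility in S already contributes κ/2 to the sum; if there is none, the connection to
  -- S alone costs at least κ/2.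
  by_cases hN : ∃ f ∈ S, f ∈ near c O v
  · obtain ⟨f, hfS, hfN⟩ := hN
    have h1 := Finset.single_le_sum hsum0 hfS
    have h2 : (c f : ℝ) * s.boost c O v f = kappa c O v / 2 := by
      have hb : s.boost c O v f = kappa c O v / (2 * c f) := by simp [LearnState.boost, hfN, hX]
      have hk := kappa_le_of_mem_near c hfN hfin
      have hk0 := kappa_nonneg c O v
      rw [hb]
      rcases eq_or_ne (c f : ℝ) 0 with h0 | h0
      · have : kappa c O v = 0 := by rw [h0] at hk; linarith
        simp [this]
      · field_simp
    have h3 : 0 ≤ (S.inf v).toReal := ENNReal.toReal_nonneg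
    linarith
  · push Not at hN
    have h1 : serviceCost c O v ≤ 2 * S.inf v := by
      rcases S.eq_empty_or_nonempty with rfl | hne
      · simp at hS
      · obtain ⟨f, hf, hfv⟩ := Finset.exists_mem_eq_inf S hne v
        rw [hfv]
        have := hN f hf
        simp only [near, Finset.mem_filter, Finset.mem_univ, true_and, not_le] at this
        exact this.le
    have h2 := ENNReal.toReal_mono (ENNReal.mul_ne_top (by norm_num) hS) h1
    rw [ENNReal.toReal_mul, ENNReal.toReal_ofNat] at h2
    have h3 := Finset.sum_nonneg hsum0
    unfold kappa
    linarith

/-- The regret is controlled by the weights of every offline solution. -/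
lemma regret_add_log_le [Nonempty F] (h : History F) (S : Finset F)
    (hS : connCost S (seen h) ≠ ∞) :
    (learnState c h).regret +
        (learnState c h).budget * Real.log (∑ f, (learnState c h).weight f) ≤
      (learnState c h).budget * Real.log (Fintype.card F) +
        ∑ f ∈ S, c f * Real.log ((learnState c h).weight f) +
        (connCost S (seen h)).toReal := by
  induction h with
  | nil => simp [learnState, connCost, seen]
  | cons p h ih =>
    obtain ⟨v, d⟩ := p
    have hsplit : connCost S (seen ((v, d) :: h)) = S.inf v + connCost S (seen h) := by
      simp [connCost, seen]
    rw [hsplit] at hS ⊢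
    have hS1 : S.inf v ≠ ∞ := (ENNReal.add_ne_top.1 hS).1
    have hS2 : connCost S (seen h) ≠ ∞ := (ENNReal.add_ne_top.1 hS).2
    specialize ih hS2
    rw [ENNReal.toReal_add hS1 hS2]
    have hv0 : 0 ≤ (S.inf v).toReal := ENNReal.toReal_nonneg
    rw [learnState]
    split_ifs with hcont
    · set O := openFacilities h
      have hfin : serviceCost c O v ≠ ∞ :=
        ((serviceCost_le_offlineOpt c O v _).trans hcont |>.trans_lt ENNReal.coe_lt_top).ne
      have hlogw : ∑ f ∈ S, (c f : ℝ) * Real.log (((learnState c h).update c O v).weight f) =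
          ∑ f ∈ S, c f * Real.log ((learnState c h).weight f) +
            ∑ f ∈ S, c f * (learnState c h).boost c O v f := by
        rw [← Finset.sum_add_distrib]
        refine Finset.sum_congr rfl fun f _ => ?_
        simp only [LearnState.update]
        rw [Real.log_mul (zero_lt_one.trans_le (weight_pos c h f)).ne' (Real.exp_pos _).ne',
          Real.log_exp]
        ring
      rw [hlogw]
      have hk := kappa_nonneg c O v
      by_cases hX : (learnState c h).cover c O v < 1
      · have h1 := budget_mul_log_sum_update_le c h hfin hX
        have h2 := half_kappa_le c (learnState c h) hfin hS1 hX
        have h3 : ((learnState c h).update c O v).regret = (learnState c h).regret +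
            kappa c O v * (1 / 2 - (learnState c h).cover c O v) := by
          simp only [LearnState.update]
          rw [min_eq_left hX.le]
        rw [h3]
        simp only [LearnState.update] at h1 ⊢
        linarith
      -- With cover at least 1 the weights stay fixed and the regret falls by κ/2.
      · have h3 : ((learnState c h).update c O v).regret = (learnState c h).regret +
            kappa c O v * (1 / 2 - 1) := by
          simp only [LearnState.update]
          rw [min_eq_right (not_lt.1 hX)]
        have h4 : ∀ f, ((learnState c h).update c O v).weight f = (learnState c h).weight f := by
          intro f
          simp [LearnState.update, LearnState.boost, hX]
        have h5 : ∑ f ∈ S, (c f : ℝ) * (learnState c h).boost c O v f = 0 := by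
          simp [LearnState.boost, hX]
        rw [h3, h5]
        simp only [h4]
        simp only [LearnState.update]
        linarith
    · have h6 : 0 ≤ (connCost S (seen h)).toReal := ENNReal.toReal_nonneg
      simp
      linarith

/-! ### The guess is within a factor 2 of the current optimum -/

lemma offlineOpt_le_budget (h : History F) (hfin : offlineOpt c (seen h) ≠ ∞) :
    offlineOpt c (seen h) ≤ (learnState c h).budget := by
  cases h with
  | nil =>
    refine (iInf_le _ ∅).trans ?_
    simp [offlineCost, seen]
  | cons p h =>
    obtain ⟨v, d⟩ := p
    rw [learnState]
    split_ifs with hcont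
    · exact hcont
    · have hfin' : offlineOpt c (v :: seen h) ≠ ∞ := hfin
      change offlineOpt c (v :: seen h) ≤ _
      simp only [ENNReal.coe_mul, ENNReal.coe_toNNReal hfin']
      exact le_mul_of_one_le_left' (by norm_num)

lemma budget_le (h : History F) (hfin : offlineOpt c (seen h) ≠ ∞) :
    ((learnState c h).budget : ℝ) ≤ 2 * (offlineOpt c (seen h)).toReal := by
  induction h with
  | nil => simp [learnState]
  | cons p h ih =>
    obtain ⟨v, d⟩ := p
    have hfin' : offlineOpt c (v :: seen h) ≠ ∞ := hfin
    have hle := offlineOpt_le_cons c v (seen h)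
    have hfin2 : offlineOpt c (seen h) ≠ ∞ := (hle.trans_lt hfin'.lt_top).ne
    change _ ≤ 2 * (offlineOpt c (v :: seen h)).toReal
    rw [learnState]
    split_ifs with hcont
    · have := ENNReal.toReal_mono hfin' hle
      have := ih hfin2
      simp only [LearnState.update]
      linarith
    · simp [ENNReal.coe_toNNReal_eq_toReal]

/-- Compare with an optimal S. Its opening cost is at most the budget and each weight at most the
total W, so its weighted logarithms are absorbed by b log W. Its connection cost, also at most b,
gives the +1. -/
theorem regret_le [Nonempty F] (h : History F) (hfin : offlineOpt c (seen h) ≠ ∞) :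
    (learnState c h).regret ≤
      (learnState c h).budget * (Real.log (Fintype.card F) + 1) := by
  obtain ⟨S, hS⟩ := exists_offlineOpt_eq c (seen h)
  have hb := offlineOpt_le_budget c h hfin
  rw [← hS] at hb hfin
  have hsum : offlineCost c S (seen h) = (∑ f ∈ S, (c f : ℝ≥0∞)) + connCost S (seen h) := rfl
  rw [hsum] at hb hfin
  obtain ⟨h1, h2⟩ := ENNReal.add_ne_top.1 hfin
  have hb' := ENNReal.toReal_mono ENNReal.coe_ne_top hb
  rw [ENNReal.toReal_add h1 h2, ENNReal.toReal_sum (by simp), ENNReal.coe_toReal] at hb'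
  simp only [ENNReal.coe_toReal] at hb'
  have hmain := regret_add_log_le c h S h2
  set s := learnState c h
  have hlogW : 0 ≤ Real.log (∑ f, s.weight f) := Real.log_nonneg (one_le_sum_weight c h)
  have h3 : ∑ f ∈ S, (c f : ℝ) * Real.log (s.weight f) ≤
      (∑ f ∈ S, (c f : ℝ)) * Real.log (∑ f, s.weight f) := by
    rw [Finset.sum_mul]
    refine Finset.sum_le_sum fun f _ => ?_
    have : Real.log (s.weight f) ≤ Real.log (∑ f, s.weight f) :=
      Real.log_le_log (zero_lt_one.trans_le (weight_pos c h f))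
        (Finset.single_le_sum (fun g _ => zero_le_one.trans (weight_pos c h g))
          (Finset.mem_univ f))
    gcongr
  have hc : ∑ f ∈ S, (c f : ℝ) ≤ s.budget := by
    linarith [ENNReal.toReal_nonneg (a := connCost S (seen h))]
  have h4 := mul_le_mul_of_nonneg_right hc hlogW
  have h5 : (0 : ℝ) ≤ ∑ f ∈ S, (c f : ℝ) := Finset.sum_nonneg fun f _ => by positivity
  linarith

end Algorithm

/-! ### The potential -/

section Potential

variable {F : Type*} [Fintype F] [DecidableEq F] (c : F → ℝ≥0)

/-- The service cost of a client, counted only if it is compatible with the guess `b`. -/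
noncomputable def pending (b : ℝ≥0) (O : Finset F) (u : Client F) : ℝ :=
  if serviceCost c ∅ u ≤ b then kappa c O u else 0

lemma pending_nonneg (b : ℝ≥0) (O : Finset F) (u : Client F) : 0 ≤ pending c b O u := by
  unfold pending
  split_ifs
  · exact kappa_nonneg c O u
  · exact le_rfl

/-- The excluded clients would renew the guess on arrival. Excluding them gives K ≤ nb, hence the
log n term after a renewal. -/
lemma pending_le (b : ℝ≥0) (O : Finset F) (u : Client F) : pending c b O u ≤ b := by
  unfold pending
  split_ifs with h
  · exact ENNReal.toReal_le_of_le_ofReal b.2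
      (by simpa using (serviceCost_anti c (Finset.empty_subset O) u).trans h)
  · exact b.2

/-- The total pending service cost of the remaining clients. -/
noncomputable def pendingCost {n : ℕ} (h : History F) (R : Fin n → Client F) : ℝ :=
  ∑ i, pending c (learnState c h).budget (openFacilities h) (R i)

/-- The pending service cost of the remaining clients, weighted by their fractional cover. -/
noncomputable def coveredCost {n : ℕ} (h : History F) (R : Fin n → Client F) : ℝ :=
  ∑ i, pending c (learnState c h).budget (openFacilities h) (R i) *
    min ((learnState c h).cover c (openFacilities h) (R i)) 1

/-- An upper bound for the expected cost that is still to come, when `V` is the offline cost. -/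
noncomputable def potential (D V : ℝ) {n : ℕ} (h : History F) (R : Fin n → Client F) : ℝ :=
  4 * ((learnState c h).budget * (Real.log (Fintype.card F) + 1) - (learnState c h).regret) +
  16 * ((learnState c h).budget *
    Real.log (1 + pendingCost c h R / (learnState c h).budget)) +
  D * (4 * V - 2 * (learnState c h).budget)

/-- A bound for the expected change of the potential and the cost on the arrival of `v`. -/
noncomputable def drift {n : ℕ} (h : History F) (R : Fin n → Client F) (v : Client F) : ℝ :=
  4 * (pending c (learnState c h).budget (openFacilities h) v *
    min ((learnState c h).cover c (openFacilities h) v) 1) -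
  4 * (pending c (learnState c h).budget (openFacilities h) v *
    (((learnState c h).budget + coveredCost c h R) /
      ((learnState c h).budget + pendingCost c h R)))

lemma pendingCost_nonneg {n : ℕ} (h : History F) (R : Fin n → Client F) :
    0 ≤ pendingCost c h R :=
  Finset.sum_nonneg fun _ _ => pending_nonneg c _ _ _

lemma coveredCost_le {n : ℕ} (h : History F) (R : Fin n → Client F) :
    coveredCost c h R ≤ pendingCost c h R :=
  Finset.sum_le_sum fun _ _ =>
    mul_le_of_le_one_right (pending_nonneg c _ _ _) (min_le_right _ _)

lemma potential_nonneg [Nonempty F] {D V : ℝ} (hD : 0 ≤ D) {n : ℕ} (h : History F)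
    (R : Fin n → Client F) (hfin : offlineOpt c (seen h) ≠ ∞)
    (hV : (offlineOpt c (seen h)).toReal ≤ V) : 0 ≤ potential c D V h R := by
  have h1 := regret_le c h hfin
  have h2 := budget_le c h hfin
  have h3 : 0 ≤ Real.log (1 + pendingCost c h R / (learnState c h).budget) :=
    Real.log_nonneg (by
      have := div_nonneg (pendingCost_nonneg c h R) (learnState c h).budget.coe_nonneg
      linarith)
  have h4 : 0 ≤ D * (4 * V - 2 * (learnState c h).budget) :=
    mul_nonneg hD (by linarith)
  have h5 := mul_nonneg (learnState c h).budget.coe_nonneg h3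
  unfold potential
  linarith

/-- For b + K > 0 the sum is 4Q - 4K(b+Q)/(b+K) = -4b(K - Q)/(b+K), and Q ≤ K. -/
lemma sum_drift_nonpos {n : ℕ} (h : History F) (R : Fin n → Client F) :
    ∑ i, drift c h R (R i) ≤ 0 := by
  unfold drift
  rw [Finset.sum_sub_distrib, ← Finset.mul_sum, ← Finset.mul_sum, ← Finset.sum_mul]
  change 4 * coveredCost c h R - 4 * (pendingCost c h R * _) ≤ 0
  have h1 := coveredCost_le c h R
  have h2 := pendingCost_nonneg c h R
  have h3 : (0 : ℝ) ≤ (learnState c h).budget := (learnState c h).budget.2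
  rcases (add_nonneg h3 h2).eq_or_lt with h0 | h0
  · have : pendingCost c h R = 0 := by linarith
    rw [← h0, this]
    simp
    linarith
  · have : coveredCost c h R ≤ pendingCost c h R *
        (((learnState c h).budget + coveredCost c h R) /
          ((learnState c h).budget + pendingCost c h R)) := by
      rw [mul_div_assoc', le_div_iff₀ h0]
      nlinarith
    linarith

lemma neg_four_mul_budget_le_drift {n : ℕ} (h : History F) (R : Fin n → Client F)
    (v : Client F) : -4 * ((learnState c h).budget : ℝ) ≤ drift c h R v := by
  have h1 := coveredCost_le c h R
  have h2 := pendingCost_nonneg c h R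
  have h3 : (0 : ℝ) ≤ (learnState c h).budget := (learnState c h).budget.2
  have h4 := pending_nonneg c (learnState c h).budget (openFacilities h) v
  have h5 := pending_le c (learnState c h).budget (openFacilities h) v
  have h6 := mul_le_of_le_one_right h4 (div_le_one_of_le₀
    (add_le_add_right h1 ((learnState c h).budget : ℝ)) (add_nonneg h3 h2))
  have h7 := mul_nonneg h4 (le_min (cover_nonneg c h (openFacilities h) v) zero_le_one)
  unfold drift
  linarith

/-! ### One step -/

lemma sum_openProb_mul_le [Nonempty F] (h : History F) (v : Client F) :
    ∑ f, openProb c h v f * c f ≤ kappa c (openFacilities h) v := by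
  have hk := kappa_nonneg c (openFacilities h) v
  calc ∑ f, openProb c h v f * c f
      ≤ ∑ f, kappa c (openFacilities h) v * (learnState c h).prob f := by
        refine Finset.sum_le_sum fun f _ => ?_
        have hp := mul_nonneg hk (prob_nonneg c h f)
        rcases eq_or_ne (c f : ℝ) 0 with h0 | h0
        · simpa [h0] using hp
        · unfold openProb
          split_ifs
          · calc _ ≤ (kappa c (openFacilities h) v * ((learnState c h).prob f / c f)) * c f := by
                  gcongr
                  exact min_le_right _ _
              _ = _ := by field_simp
          · simpa using hp
    _ = kappa c (openFacilities h) v := by rw [← Finset.mul_sum, sum_prob, mul_one]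

/-- Truncating the opening probabilities at 1 costs nothing, because only a lower bound s ≤ 1 is
wanted. -/
lemma le_sum_min_one {ι : Type*} (N : Finset ι) {a : ι → ℝ} (ha : ∀ i, 0 ≤ a i) {s : ℝ}
    (hs1 : s ≤ 1) (hs : s ≤ ∑ i ∈ N, a i) : s ≤ ∑ i ∈ N, min 1 (a i) := by
  by_cases hN : ∃ i ∈ N, 1 ≤ a i
  · obtain ⟨i, hi, h1⟩ := hN
    have := Finset.single_le_sum (f := fun i => min 1 (a i))
      (fun i _ => le_min zero_le_one (ha i)) hi
    simp only [min_eq_left h1] at this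
    exact hs1.trans this
  · push Not at hN
    rwa [Finset.sum_congr rfl fun i hi => min_eq_right (hN i hi).le]

/-- Sampling halves the service cost of `u` with a probability that grows with its fractional
cover. -/
lemma sum_subsetWeight_mul_pending_le [Nonempty F] (h : History F) (v : Client F)
    (hcont : offlineOpt c (v :: seen h) ≤ (learnState c h).budget) (u : Client F) :
    ∑ S : Finset F, subsetWeight (openProb c h v) S *
        pending c (learnState c h).budget (openFacilities ((v, serve c h v S) :: h)) u ≤
      pending c (learnState c h).budget (openFacilities h) u *
        (1 - kappa c (openFacilities h) v *
          min ((learnState c h).cover c (openFacilities h) u) 1 / (learnState c h).budget / 4) := by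
  set s := learnState c h with hs
  set O := openFacilities h with hO
  have hkv := kappa_nonneg c O v
  have hkb : kappa c O v ≤ s.budget := ENNReal.toReal_le_of_le_ofReal s.budget.2
    (by simpa using (serviceCost_le_offlineOpt c O v _).trans hcont)
  have hcov0 := cover_nonneg c h O u
  rw [← hs] at hcov0
  by_cases hu : serviceCost c ∅ u ≤ s.budget
  swap
  · simp [pending, hu]
  simp only [pending, hu, if_true]
  have hfin : serviceCost c O u ≠ ∞ := ((serviceCost_anti c (Finset.empty_subset O) u).trans hu
    |>.trans_lt ENNReal.coe_lt_top).ne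
  -- A sample that hits a facility near u halves its service cost; any other sample does not
  -- increase it.
  have hpt : ∀ S : Finset F, kappa c (openFacilities ((v, serve c h v S) :: h)) u ≤
      kappa c O u / 2 + kappa c O u / 2 * (if Disjoint S (near c O u) then 1 else 0) := by
    intro S
    have hsub : O ⊆ openFacilities ((v, serve c h v S) :: h) := Finset.subset_union_right
    split_ifs with hd
    · have := ENNReal.toReal_mono hfin (serviceCost_anti c hsub u)
      simp only [kappa] at this ⊢
      linarith
    · obtain ⟨f, hfS, hfN⟩ := Finset.not_disjoint_iff.1 hd
      have hmem : f ∈ openFacilities ((v, serve c h v S) :: h) := by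
        simp [openFacilities, serve, hfS]
      have h1 : 2 * u f ≤ serviceCost c O u := by simpa [near] using hfN
      have h2 := (mul_le_mul_right (serviceCost_le_of_mem c u hmem) 2).trans h1
      have h3 := ENNReal.toReal_mono hfin h2
      rw [ENNReal.toReal_mul, ENNReal.toReal_ofNat] at h3
      simp only [kappa]
      linarith
  have hprob : ∏ f ∈ near c O u, (1 - openProb c h v f) ≤
      1 - kappa c O v * min (s.cover c O u) 1 / s.budget / 2 := by
    refine prod_one_sub_le (openProb_le_one c h v) _ ?_ ?_ ?_
    · exact div_nonneg (mul_nonneg hkv (le_min hcov0 zero_le_one)) s.budget.2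
    · refine div_le_one_of_le₀ ((mul_le_of_le_one_right hkv (min_le_right _ _)).trans hkb)
        s.budget.2
    · have hop : ∀ f, openProb c h v f = min 1 (kappa c O v * (s.prob f / c f)) := by
        intro f
        unfold openProb
        rw [if_pos hcont]
      simp only [hop]
      refine le_sum_min_one _ (fun f => mul_nonneg hkv
        (div_nonneg (prob_nonneg c h f) (by positivity))) ?_ ?_
      · exact div_le_one_of_le₀ ((mul_le_of_le_one_right hkv (min_le_right _ _)).trans hkb)
          s.budget.2
      · have hsum0 : 0 ≤ ∑ f ∈ near c O u, kappa c O v * (s.prob f / c f) :=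
          Finset.sum_nonneg fun f _ => mul_nonneg hkv
            (div_nonneg (prob_nonneg c h f) (by positivity))
        rcases eq_or_lt_of_le (show (0 : ℝ) ≤ s.budget from s.budget.2) with h0 | h0
        · rw [← h0, div_zero]
          exact hsum0
        · rw [div_le_iff₀ h0]
          calc kappa c O v * min (s.cover c O u) 1 ≤ kappa c O v * s.cover c O u := by
                gcongr
                exact min_le_left _ _
            _ = _ := by
                rw [LearnState.cover, Finset.mul_sum, Finset.sum_mul]
                exact Finset.sum_congr rfl fun f _ => by ring
  calc _ ≤ ∑ S : Finset F, subsetWeight (openProb c h v) S *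
        (kappa c O u / 2 + kappa c O u / 2 * (if Disjoint S (near c O u) then 1 else 0)) :=
        Finset.sum_le_sum fun S _ => mul_le_mul_of_nonneg_left (hpt S)
          (subsetWeight_nonneg (openProb_nonneg c h v) (openProb_le_one c h v) S)
    _ = kappa c O u / 2 * ∑ S : Finset F, subsetWeight (openProb c h v) S +
        kappa c O u / 2 * ∑ S : Finset F,
          (if Disjoint S (near c O u) then subsetWeight (openProb c h v) S else 0) := by
        rw [Finset.mul_sum, Finset.mul_sum, ← Finset.sum_add_distrib]
        refine Finset.sum_congr rfl fun S _ => ?_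
        split_ifs <;> ring
    _ ≤ _ := by
        rw [sum_subsetWeight, sum_subsetWeight_of_disjoint]
        have := mul_le_mul_of_nonneg_left hprob (half_pos (zero_lt_one' ℝ)).le
        have := mul_le_mul_of_nonneg_left hprob
          (div_nonneg (kappa_nonneg c O u) (zero_le_two (α := ℝ)))
        linarith

/-- Tangent line of a concave function at K: linear in K', so an expectation over K' passes through.
-/
lemma mul_log_one_add_div_le {b K K' : ℝ} (hb : 0 < b) (hK : 0 ≤ K) (hK' : 0 ≤ K') :
    b * Real.log (1 + K' / b) ≤ b * Real.log (1 + K / b) + b * ((K' - K) / (b + K)) := by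
  have h1 : 0 < 1 + K / b := by positivity
  have h2 : 0 < 1 + K' / b := by positivity
  have h3 := Real.log_le_sub_one_of_pos (div_pos h2 h1)
  rw [Real.log_div h2.ne' h1.ne'] at h3
  have h4 : (1 + K' / b) / (1 + K / b) - 1 = (K' - K) / (b + K) := by
    have : b + K ≠ 0 := by positivity
    field_simp
    ring
  rw [h4] at h3
  rw [← mul_add]
  gcongr
  linarith

/-- The expected cost of the arrival of `v`, together with the expected new potential. -/
noncomputable def expectedStep [Nonempty F] (D V : ℝ) {n : ℕ} (h : History F) (v : Client F)
    (R' : Fin n → Client F) : ℝ :=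
  ∑ S : Finset F, subsetWeight (openProb c h v) S *
    ((kappa c (openFacilities h) v + ∑ f ∈ S, (c f : ℝ)) +
      potential c D V ((v, serve c h v S) :: h) R')

lemma expectedStep_le_of_continue [Nonempty F] (D V : ℝ) {n : ℕ} (h : History F)
    (R : Fin (n + 1) → Client F) (R' : Fin n → Client F) (v : Client F)
    (hR : ∀ G : Client F → ℝ, ∑ i, G (R' i) = ∑ i, G (R i) - G v)
    (hcont : offlineOpt c (v :: seen h) ≤ (learnState c h).budget) :
    expectedStep c D V h v R' ≤ potential c D V h R + drift c h R v := by
  have hstate : ∀ d, learnState c ((v, d) :: h) =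
      (learnState c h).update c (openFacilities h) v := fun d => by
    rw [learnState, if_pos hcont]
  have hcost := sum_openProb_mul_le c h v
  have hpend := sum_subsetWeight_mul_pending_le c h v hcont
  have hpv : pending c (learnState c h).budget (openFacilities h) v =
      kappa c (openFacilities h) v :=
    if_pos ((serviceCost_empty_le_offlineOpt c v _).trans hcont)
  have hpb := pending_le c (learnState c h).budget (openFacilities h) v
  have hw0 := subsetWeight_nonneg (openProb_nonneg c h v) (openProb_le_one c h v)
  have hKnn := pendingCost_nonneg c h R
  set s := learnState c h with hs
  set O := openFacilities h with hO
  set k := kappa c O v with hk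
  have hk0 : 0 ≤ k := kappa_nonneg c O v
  set K := pendingCost c h R with hK
  set Q := coveredCost c h R with hQ
  set X := min (s.cover c O v) 1 with hX
  have hX1 : X ≤ 1 := min_le_right _ _
  let K' : Finset F → ℝ := fun S => pendingCost c ((v, serve c h v S) :: h) R'
  have hK'nn : ∀ S, 0 ≤ K' S := fun S => pendingCost_nonneg c _ R'
  -- The arrival removes v from both sums: k from K, and k X from Q.
  have hsumK' : ∑ S : Finset F, subsetWeight (openProb c h v) S * K' S ≤
      K - k - k / s.budget / 4 * (Q - k * X) := by
    have e1 : ∀ S, K' S = ∑ i, pending c s.budget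
        (openFacilities ((v, serve c h v S) :: h)) (R' i) := fun S => by
      simp only [K', pendingCost, hstate]
      rfl
    simp only [e1, Finset.mul_sum]
    rw [Finset.sum_comm]
    refine (Finset.sum_le_sum fun i _ => hpend (R' i)).trans_eq ?_
    rw [hR fun u => pending c s.budget O u *
      (1 - k * min (s.cover c O u) 1 / s.budget / 4), hpv]
    have e2 : ∑ i, pending c s.budget O (R i) *
        (1 - k * min (s.cover c O (R i)) 1 / s.budget / 4) = K - k / s.budget / 4 * Q := by
      rw [hK, hQ, pendingCost, coveredCost, Finset.mul_sum, ← Finset.sum_sub_distrib]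
      exact Finset.sum_congr rfl fun i _ => by ring
    rw [e2]
    ring
  have hpot : ∀ S, potential c D V ((v, serve c h v S) :: h) R' =
      4 * (s.budget * (Real.log (Fintype.card F) + 1) - (s.regret + k * (1 / 2 - X))) +
      16 * (s.budget * Real.log (1 + K' S / s.budget)) + D * (4 * V - 2 * s.budget) := by
    intro S
    simp only [potential, hstate]
    rfl
  have hsplit : expectedStep c D V h v R' =
      (k + ∑ f, openProb c h v f * c f) +
      (4 * (s.budget * (Real.log (Fintype.card F) + 1) - (s.regret + k * (1 / 2 - X))) +
        D * (4 * V - 2 * s.budget)) +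
      16 * ∑ S : Finset F, subsetWeight (openProb c h v) S *
        (s.budget * Real.log (1 + K' S / s.budget)) := by
    have e3 : ∀ (A : ℝ) (f g : Finset F → ℝ),
        ∑ S : Finset F, subsetWeight (openProb c h v) S * (A + f S + 16 * g S) =
          A + ∑ S : Finset F, subsetWeight (openProb c h v) S * f S +
            16 * ∑ S : Finset F, subsetWeight (openProb c h v) S * g S := by
      intro A f g
      have : ∀ S, subsetWeight (openProb c h v) S * (A + f S + 16 * g S) =
          A * subsetWeight (openProb c h v) S + subsetWeight (openProb c h v) S * f S +
            16 * (subsetWeight (openProb c h v) S * g S) := fun S => by ring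
      simp only [this]
      rw [Finset.sum_add_distrib, Finset.sum_add_distrib, ← Finset.mul_sum, ← Finset.mul_sum,
        sum_subsetWeight, mul_one]
    rw [← sum_subsetWeight_mul_sum, add_right_comm k, ← e3, expectedStep]
    refine Finset.sum_congr rfl fun S _ => ?_
    rw [hpot]
    ring
  have hlog : ∑ S : Finset F, subsetWeight (openProb c h v) S *
      (s.budget * Real.log (1 + K' S / s.budget)) ≤
      s.budget * Real.log (1 + K / s.budget) - k / 4 * ((s.budget + Q) / (s.budget + K)) := by
    rcases eq_or_lt_of_le (show (0 : ℝ) ≤ s.budget from s.budget.2) with h0 | h0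
    · have : k = 0 := by linarith
      simp [← h0, this]
    · have hbK : 0 < s.budget + K := by linarith
      calc _ ≤ ∑ S : Finset F, subsetWeight (openProb c h v) S *
            (s.budget * Real.log (1 + K / s.budget) + s.budget * ((K' S - K) / (s.budget + K))) :=
            Finset.sum_le_sum fun S _ => mul_le_mul_of_nonneg_left
              (mul_log_one_add_div_le h0 hKnn (hK'nn S)) (hw0 S)
        _ = s.budget * Real.log (1 + K / s.budget) + s.budget / (s.budget + K) *
            (∑ S : Finset F, subsetWeight (openProb c h v) S * K' S - K) := by
            have e3 : ∀ S, subsetWeight (openProb c h v) S *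
                (s.budget * Real.log (1 + K / s.budget) +
                  s.budget * ((K' S - K) / (s.budget + K))) =
                (s.budget * Real.log (1 + K / s.budget) - s.budget / (s.budget + K) * K) *
                  subsetWeight (openProb c h v) S +
                s.budget / (s.budget + K) * (subsetWeight (openProb c h v) S * K' S) := by
              intro S
              ring
            simp only [e3]
            rw [Finset.sum_add_distrib, ← Finset.mul_sum, ← Finset.mul_sum, sum_subsetWeight]
            ring
        _ ≤ s.budget * Real.log (1 + K / s.budget) + s.budget / (s.budget + K) *
            (-(k / 4 * ((s.budget + Q) / s.budget))) := by
            gcongr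
            -- Losing v's own share of Q costs at most k/4, less than the k gained by its departure;
            -- a decrease of k/4 is all that is kept.
            have e4 : k / s.budget / 4 * (k * X) ≤ k / 4 := by
              have : k * X ≤ s.budget := by nlinarith
              calc k / s.budget / 4 * (k * X) ≤ k / s.budget / 4 * s.budget := by gcongr
                _ = k / 4 := by field_simp
            have e5 : k / 4 * ((s.budget + Q) / s.budget) = k / 4 + k / s.budget / 4 * Q := by
              field_simp
            rw [e5]
            linarith
        _ = _ := by
            field_simp
            ring
  have hdrift : drift c h R v = 4 * (k * X) - 4 * (k * ((s.budget + Q) / (s.budget + K))) := by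
    rw [drift, hpv]
  have hpotR : potential c D V h R =
      4 * (s.budget * (Real.log (Fintype.card F) + 1) - s.regret) +
      16 * (s.budget * Real.log (1 + K / s.budget)) + D * (4 * V - 2 * s.budget) := rfl
  rw [hsplit, hdrift, hpotR]
  linarith

lemma expectedStep_le_of_restart [Nonempty F] {D V : ℝ} {n : ℕ} (h : History F)
    (R : Fin (n + 1) → Client F) (R' : Fin n → Client F) (v : Client F)
    (hD : 4 * (Real.log (Fintype.card F) + 1) + 16 * Real.log (1 + n) + 3 ≤ D)
    (hfin : offlineOpt c (v :: seen h) ≠ ∞)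
    (hcont : ¬ offlineOpt c (v :: seen h) ≤ (learnState c h).budget) :
    expectedStep c D V h v R' ≤ potential c D V h R + drift c h R v := by
  have hstate : ∀ d, learnState c ((v, d) :: h) =
      ⟨2 * (offlineOpt c (v :: seen h)).toNNReal, 1, 0⟩ := fun d => by
    rw [learnState, if_neg hcont]
  have hfin0 : offlineOpt c (seen h) ≠ ∞ :=
    ((offlineOpt_le_cons c v (seen h)).trans_lt hfin.lt_top).ne
  set b' : ℝ≥0 := 2 * (offlineOpt c (v :: seen h)).toNNReal with hb'
  have hb'r : (b' : ℝ) = 2 * (offlineOpt c (v :: seen h)).toReal := by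
    rw [hb']
    simp [ENNReal.coe_toNNReal_eq_toReal]
  have hk : kappa c (openFacilities h) v ≤ b' / 2 := by
    have := ENNReal.toReal_mono hfin (serviceCost_le_offlineOpt c (openFacilities h) v (seen h))
    unfold kappa
    linarith
  have hlt : 2 * ((learnState c h).budget : ℝ) < b' := by
    have := (ENNReal.toReal_lt_toReal ENNReal.coe_ne_top hfin).2 (not_le.1 hcont)
    rw [ENNReal.coe_toReal] at this
    linarith
  have hb0 : (0 : ℝ) ≤ (learnState c h).budget := (learnState c h).budget.2
  have hb'0 : (0 : ℝ) < b' := by linarith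
  have hlognn : 0 ≤ Real.log (Fintype.card F) := Real.log_natCast_nonneg _
  have hlogn : 0 ≤ Real.log (1 + n) := Real.log_nonneg (by linarith [n.cast_nonneg (α := ℝ)])
  have hpot : ∀ S, potential c D V ((v, serve c h v S) :: h) R' ≤
      4 * (b' * (Real.log (Fintype.card F) + 1)) + 16 * (b' * Real.log (1 + n)) +
        D * (4 * V - 2 * b') := by
    intro S
    have hK : pendingCost c ((v, serve c h v S) :: h) R' / b' ≤ n := by
      rw [div_le_iff₀ hb'0, pendingCost, hstate]
      refine (Finset.sum_le_sum fun i _ => pending_le c b' _ (R' i)).trans_eq ?_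
      simp
    have hK0 := div_nonneg (pendingCost_nonneg c ((v, serve c h v S) :: h) R') hb'0.le
    have hlog : Real.log (1 + pendingCost c ((v, serve c h v S) :: h) R' / b') ≤
        Real.log (1 + n) := Real.log_le_log (by linarith) (by linarith)
    have := mul_le_mul_of_nonneg_left hlog hb'0.le
    simp only [potential, hstate]
    linarith
  have hdrift := neg_four_mul_budget_le_drift c h R v
  have hreg := regret_le c h hfin0
  have hlogK : 0 ≤ Real.log (1 + pendingCost c h R / (learnState c h).budget) :=
    Real.log_nonneg (by
      have := div_nonneg (pendingCost_nonneg c h R) hb0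
      linarith)
  have hlogK' := mul_nonneg hb0 hlogK
  have hbound : b' / 2 + (4 * (b' * (Real.log (Fintype.card F) + 1)) +
      16 * (b' * Real.log (1 + n)) + D * (4 * V - 2 * b')) ≤
      potential c D V h R + drift c h R v := by
    -- Since b' > 2b, the last term of the potential releases at least D b'. This pays for the fresh
    -- learning and covering terms, the service cost b'/2 and the drift bound 4b < 2b'; hence the 3
    -- in the hypothesis on D.
    have h1 : D * b' ≤ D * (2 * b' - 2 * (learnState c h).budget) :=
      mul_le_mul_of_nonneg_left (by linarith) (by linarith)
    have h2 := mul_le_mul_of_nonneg_right hD hb'0.le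
    unfold potential
    linarith
  have hprob0 : ∀ f, openProb c h v f = 0 := fun f => if_neg hcont
  calc expectedStep c D V h v R'
      ≤ ∑ S : Finset F, subsetWeight (openProb c h v) S *
        ((potential c D V h R + drift c h R v) + ∑ f ∈ S, (c f : ℝ)) := by
        refine Finset.sum_le_sum fun S _ => mul_le_mul_of_nonneg_left ?_
          (subsetWeight_nonneg (openProb_nonneg c h v) (openProb_le_one c h v) S)
        have := hpot S
        linarith
    _ = potential c D V h R + drift c h R v := by
        simp only [mul_add]
        rw [Finset.sum_add_distrib, sum_subsetWeight_mul_sum, Finset.sum_add_distrib,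
          ← Finset.sum_mul, ← Finset.sum_mul, sum_subsetWeight]
        simp [hprob0]

end Potential

/-! ### The expected cost -/

section Cost

variable {F : Type*} [DecidableEq F] (c : F → ℝ≥0)

/-- The expected final cost when the clients of a list arrive after the history `h`. -/
noncomputable def OnlineAlgorithm.costFrom (A : OnlineAlgorithm F) (h : History F)
    (vs : List (Client F)) : ℝ≥0∞ :=
  ∑' h' : History F, A.run h vs h' * historyCost c h'

lemma OnlineAlgorithm.costFrom_nil (A : OnlineAlgorithm F) (h : History F) :
    A.costFrom c h [] = historyCost c h := by
  classical
  rw [costFrom, tsum_eq_single h]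
  · simp [run]
  · intro h' hne
    simp [run, PMF.pure_apply, hne]

lemma tsum_bind_mul {α β : Type*} (p : PMF α) (q : α → PMF β) (g : β → ℝ≥0∞) :
    ∑' b, p.bind q b * g b = ∑' a, p a * ∑' b, q a b * g b := by
  simp only [PMF.bind_apply, ← ENNReal.tsum_mul_right, ← ENNReal.tsum_mul_left]
  rw [ENNReal.tsum_comm]
  simp only [mul_assoc]

lemma costFrom_learnOrCover_cons [Fintype F] [Nonempty F] (h : History F) (v : Client F)
    (vs : List (Client F)) :
    (learnOrCover c).costFrom c h (v :: vs) =
      ∑ S : Finset F, ENNReal.ofReal (subsetWeight (openProb c h v) S) *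
        (learnOrCover c).costFrom c ((v, serve c h v S) :: h) vs := by
  rw [OnlineAlgorithm.costFrom]
  simp only [OnlineAlgorithm.run]
  have : (learnOrCover c).act h v = (subsetPMF (openProb c h v) (openProb_nonneg c h v)
    (openProb_le_one c h v)).map (serve c h v) := rfl
  rw [this, PMF.bind_map, tsum_bind_mul, tsum_fintype]
  rfl

/-- Only an inequality, as sampled facilities may be open already or coincide with the cheapest one.
-/
lemma historyCost_serve_le [Fintype F] [Nonempty F] (h : History F) (v : Client F)
    (S : Finset F) :
    historyCost c ((v, serve c h v S) :: h) ≤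
      historyCost c h + (serviceCost c (openFacilities h) v + ∑ f ∈ S, (c f : ℝ≥0∞)) := by
  set O := openFacilities h with hO
  set g := cheapest c O v with hg
  have hopen : ∑ f ∈ openFacilities ((v, serve c h v S) :: h), (c f : ℝ≥0∞) ≤
      ∑ f ∈ O, (c f : ℝ≥0∞) + ∑ f ∈ S, (c f : ℝ≥0∞) + (if g ∈ O then 0 else (c g : ℝ≥0∞)) := by
    have hunion : ∀ A B : Finset F, ∑ f ∈ A ∪ B, (c f : ℝ≥0∞) ≤
        ∑ f ∈ A, (c f : ℝ≥0∞) + ∑ f ∈ B, (c f : ℝ≥0∞) := fun A B => by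
      rw [← Finset.sum_union_inter]
      exact le_self_add
    have heq : openFacilities ((v, serve c h v S) :: h) = insert g S ∪ O := rfl
    rw [heq]
    split_ifs with hgO
    · rw [Finset.insert_union, Finset.insert_eq_of_mem (Finset.mem_union_right S hgO), add_zero,
        add_comm]
      exact hunion S O
    · rw [Finset.insert_eq]
      refine (hunion _ _).trans ?_
      refine (add_le_add_left (hunion _ _) _).trans_eq ?_
      rw [Finset.sum_singleton]
      ring
  have hserv := serviceCost_eq_cheapest c O v
  rw [← hg] at hserv
  have hconn : historyCost c ((v, serve c h v S) :: h) =
      ∑ f ∈ openFacilities ((v, serve c h v S) :: h), (c f : ℝ≥0∞) +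
        (v g + (h.map fun p => p.1 p.2.2).sum) := by
    rw [historyCost, List.map_cons, List.sum_cons]
    rfl
  rw [hconn, hserv, historyCost]
  refine (add_le_add_left hopen _).trans_eq ?_
  rw [← hO]
  ring

/-- Splitting a uniformly random order according to the client that arrives first. -/
lemma sum_perm_ofFn {α M : Type*} [AddCommMonoid M] {n : ℕ} (R : Fin (n + 1) → α)
    (G : List α → M) :
    ∑ σ : Equiv.Perm (Fin (n + 1)), G (List.ofFn fun i => R (σ i)) =
      ∑ p : Fin (n + 1), ∑ e : Equiv.Perm (Fin n),
        G (R p :: List.ofFn fun i => R (Equiv.swap 0 p (e i).succ)) := by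
  rw [← Equiv.sum_comp Equiv.Perm.decomposeFin.symm, Fintype.sum_prod_type]
  refine Finset.sum_congr rfl fun p _ => Finset.sum_congr rfl fun e _ => ?_
  rw [List.ofFn_succ]
  simp only [Equiv.Perm.decomposeFin_symm_apply_zero, Equiv.Perm.decomposeFin_symm_apply_succ]

lemma add_sum_swap_succ {α M : Type*} [AddCommMonoid M] {n : ℕ} (R : Fin (n + 1) → α)
    (p : Fin (n + 1)) (G : α → M) :
    G (R p) + ∑ i : Fin n, G (R (Equiv.swap 0 p i.succ)) = ∑ i, G (R i) := by
  rw [← Equiv.sum_comp (Equiv.swap 0 p) fun i => G (R i), Fin.sum_univ_succ,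
    Equiv.swap_apply_left]

lemma expectedStep_le [Fintype F] [Nonempty F] {D V : ℝ} {n : ℕ} (h : History F)
    (R : Fin (n + 1) → Client F) (p : Fin (n + 1))
    (hD : 4 * (Real.log (Fintype.card F) + 1) + 16 * Real.log (1 + n) + 3 ≤ D)
    (hfin : offlineOpt c (R p :: seen h) ≠ ∞) :
    expectedStep c D V h (R p) (fun i : Fin n => R (Equiv.swap 0 p i.succ)) ≤
      potential c D V h R + drift c h R (R p) := by
  by_cases hcont : offlineOpt c (R p :: seen h) ≤ (learnState c h).budget
  · refine expectedStep_le_of_continue c D V h R _ (R p) (fun G => ?_) hcont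
    rw [← add_sum_swap_succ R p G]
    ring
  · exact expectedStep_le_of_restart c h R _ (R p) hD hfin hcont

lemma offlineOpt_seen_le {V : ℝ≥0} {n : ℕ} {h : History F} {R : Fin n → Client F} {S : Finset F}
    (hS : offlineCost c S (seen h) + ∑ i, S.inf (R i) ≤ V) :
    offlineOpt c (seen h) ≠ ∞ ∧ (offlineOpt c (seen h)).toReal ≤ V := by
  have h1 : offlineOpt c (seen h) ≤ V := (iInf_le _ S).trans (le_self_add.trans hS)
  exact ⟨(h1.trans_lt ENNReal.coe_lt_top).ne,
    ENNReal.toReal_le_of_le_ofReal V.coe_nonneg (by simpa using h1)⟩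

/-- Induction on the number of remaining clients. S is a fixed offline solution for seen and
remaining clients together, so its cost, bounded by V, is unaffected by the order of arrival. -/
theorem sum_costFrom_learnOrCover_le [Fintype F] [Nonempty F] (V : ℝ≥0) (D : ℝ) (n : ℕ)
    (hD : 4 * (Real.log (Fintype.card F) + 1) + 16 * Real.log (1 + n) + 3 ≤ D)
    (h : History F) (R : Fin n → Client F) (S : Finset F)
    (hS : offlineCost c S (seen h) + ∑ i, S.inf (R i) ≤ V) :
    ∑ σ : Equiv.Perm (Fin n), (learnOrCover c).costFrom c h (List.ofFn fun i => R (σ i)) ≤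
      (n.factorial : ℝ≥0∞) * (historyCost c h + ENNReal.ofReal (potential c D V h R)) := by
  induction n generalizing h with
  | zero => simp [OnlineAlgorithm.costFrom_nil]
  | succ n ih =>
    have hDn : 4 * (Real.log (Fintype.card F) + 1) + 16 * Real.log (1 + n) + 3 ≤ D := by
      have : Real.log (1 + n) ≤ Real.log (1 + (n + 1 : ℕ)) :=
        Real.log_le_log (by positivity) (by push_cast; linarith)
      linarith
    have hD0 : 0 ≤ D := by
      have h1 := Real.log_natCast_nonneg (Fintype.card F)
      have h2 : 0 ≤ Real.log (1 + n) :=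
        Real.log_nonneg (by linarith [n.cast_nonneg (α := ℝ)])
      linarith
    let R' : Fin (n + 1) → Fin n → Client F := fun p i => R (Equiv.swap 0 p i.succ)
    have hS' : ∀ p T, offlineCost c S (seen ((R p, serve c h (R p) T) :: h)) +
        ∑ i, S.inf (R' p i) ≤ V := by
      intro p T
      refine le_trans (le_of_eq ?_) hS
      rw [← add_sum_swap_succ R p fun u => S.inf u]
      change offlineCost c S (R p :: seen h) + _ = _
      rw [offlineCost_cons]
      ring
    have hopt := fun p T => offlineOpt_seen_le c (hS' p T)
    have hfin : ∀ p, offlineOpt c (R p :: seen h) ≠ ∞ := fun p => (hopt p ∅).1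
    have hw0 : ∀ p T, 0 ≤ subsetWeight (openProb c h (R p)) T := fun p =>
      subsetWeight_nonneg (openProb_nonneg c h (R p)) (openProb_le_one c h (R p))
    have hpot0 : ∀ p T, 0 ≤ potential c D V ((R p, serve c h (R p) T) :: h) (R' p) :=
      fun p T => potential_nonneg c hD0 _ _ (hopt p T).1 (hopt p T).2
    have hstep0 : ∀ p T, 0 ≤ subsetWeight (openProb c h (R p)) T *
        ((kappa c (openFacilities h) (R p) + ∑ f ∈ T, (c f : ℝ)) +
          potential c D V ((R p, serve c h (R p) T) :: h) (R' p)) := fun p T =>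
      mul_nonneg (hw0 p T) (add_nonneg (add_nonneg (kappa_nonneg c _ _)
        (Finset.sum_nonneg fun f _ => (c f).coe_nonneg)) (hpot0 p T))
    have hone : ∀ p, ∑ T : Finset F, ENNReal.ofReal (subsetWeight (openProb c h (R p)) T) *
        (historyCost c ((R p, serve c h (R p) T) :: h) +
          ENNReal.ofReal (potential c D V ((R p, serve c h (R p) T) :: h) (R' p))) ≤
        historyCost c h + ENNReal.ofReal (potential c D V h R + drift c h R (R p)) := by
      intro p
      have hserv : serviceCost c (openFacilities h) (R p) ≠ ∞ :=
        ((serviceCost_le_offlineOpt c _ (R p) (seen h)).trans_lt (hfin p).lt_top).ne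
      calc _ ≤ ∑ T : Finset F, (ENNReal.ofReal (subsetWeight (openProb c h (R p)) T) *
            historyCost c h + ENNReal.ofReal (subsetWeight (openProb c h (R p)) T *
              ((kappa c (openFacilities h) (R p) + ∑ f ∈ T, (c f : ℝ)) +
                potential c D V ((R p, serve c h (R p) T) :: h) (R' p)))) := by
            refine Finset.sum_le_sum fun T _ => ?_
            have hc0 : 0 ≤ ∑ f ∈ T, (c f : ℝ) := Finset.sum_nonneg fun f _ => (c f).coe_nonneg
            rw [ENNReal.ofReal_mul (hw0 p T), ← mul_add, ENNReal.ofReal_add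
              (add_nonneg (kappa_nonneg c _ _) hc0) (hpot0 p T),
              ENNReal.ofReal_add (kappa_nonneg c _ _) hc0, kappa, ENNReal.ofReal_toReal hserv,
              ENNReal.ofReal_sum_of_nonneg fun f _ => (c f).coe_nonneg, ← add_assoc]
            simp only [ENNReal.ofReal_coe_nnreal]
            gcongr
            exact historyCost_serve_le c h (R p) T
        _ = historyCost c h + ENNReal.ofReal (expectedStep c D V h (R p) (R' p)) := by
            rw [Finset.sum_add_distrib, ← Finset.sum_mul,
              ← ENNReal.ofReal_sum_of_nonneg fun T _ => hw0 p T, sum_subsetWeight,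
              ENNReal.ofReal_one, one_mul,
              ← ENNReal.ofReal_sum_of_nonneg fun T _ => hstep0 p T, expectedStep]
        _ ≤ _ := by
            gcongr
            exact expectedStep_le c h R p hDn (hfin p)
    -- Needed to move the sum over p inside `ENNReal.ofReal`, where drifts of opposite sign can
    -- cancel.
    have hnn : ∀ p, 0 ≤ potential c D V h R + drift c h R (R p) := fun p =>
      (Finset.sum_nonneg fun T _ => hstep0 p T).trans (expectedStep_le c h R p hDn (hfin p))
    calc _ = ∑ p : Fin (n + 1), ∑ e : Equiv.Perm (Fin n), ∑ T : Finset F,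
          ENNReal.ofReal (subsetWeight (openProb c h (R p)) T) *
            (learnOrCover c).costFrom c ((R p, serve c h (R p) T) :: h)
              (List.ofFn fun i => R' p (e i)) := by
          rw [sum_perm_ofFn]
          simp only [costFrom_learnOrCover_cons]
          rfl
      _ = ∑ p : Fin (n + 1), ∑ T : Finset F,
          ENNReal.ofReal (subsetWeight (openProb c h (R p)) T) *
            ∑ e : Equiv.Perm (Fin n),
              (learnOrCover c).costFrom c ((R p, serve c h (R p) T) :: h)
                (List.ofFn fun i => R' p (e i)) := by
          refine Finset.sum_congr rfl fun p _ => ?_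
          rw [Finset.sum_comm]
          simp only [Finset.mul_sum]
      _ ≤ ∑ p : Fin (n + 1), ∑ T : Finset F,
          ENNReal.ofReal (subsetWeight (openProb c h (R p)) T) * ((n.factorial : ℝ≥0∞) *
            (historyCost c ((R p, serve c h (R p) T) :: h) +
              ENNReal.ofReal (potential c D V ((R p, serve c h (R p) T) :: h) (R' p)))) := by
          refine Finset.sum_le_sum fun p _ => Finset.sum_le_sum fun T _ => ?_
          gcongr
          exact ih hDn _ _ (hS' p T)
      _ = (n.factorial : ℝ≥0∞) * ∑ p : Fin (n + 1), ∑ T : Finset F,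
          ENNReal.ofReal (subsetWeight (openProb c h (R p)) T) *
            (historyCost c ((R p, serve c h (R p) T) :: h) +
              ENNReal.ofReal (potential c D V ((R p, serve c h (R p) T) :: h) (R' p))) := by
          simp only [Finset.mul_sum]
          refine Finset.sum_congr rfl fun p _ => Finset.sum_congr rfl fun T _ => ?_
          ring
      _ ≤ (n.factorial : ℝ≥0∞) * ∑ p : Fin (n + 1),
          (historyCost c h + ENNReal.ofReal (potential c D V h R + drift c h R (R p))) := by
          gcongr with p
          exact hone p
      _ ≤ (n.factorial : ℝ≥0∞) * (((n + 1 : ℕ) : ℝ≥0∞) *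
          (historyCost c h + ENNReal.ofReal (potential c D V h R))) := by
          gcongr
          rw [Finset.sum_add_distrib, ← ENNReal.ofReal_sum_of_nonneg fun p _ => hnn p,
            Finset.sum_add_distrib, mul_add]
          simp only [Finset.sum_const, Finset.card_univ, Fintype.card_fin, nsmul_eq_mul]
          gcongr
          rw [← ENNReal.ofReal_natCast, ← ENNReal.ofReal_mul (Nat.cast_nonneg _)]
          exact ENNReal.ofReal_le_ofReal (by linarith [sum_drift_nonpos c h R])
      _ = _ := by
          rw [Nat.factorial_succ]
          push_cast
          ring

theorem randomOrderCost_learnOrCover_le [Fintype F] [Nonempty F] {D : ℝ} {n : ℕ}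
    (hD : 4 * (Real.log (Fintype.card F) + 1) + 16 * Real.log (1 + n) + 3 ≤ D)
    (clients : Fin n → Client F) (hfin : opt c clients ≠ ∞) :
    (learnOrCover c).randomOrderCost c clients ≤ ENNReal.ofReal (4 * D) * opt c clients := by
  obtain ⟨S, hS⟩ := exists_offlineOpt_eq c (List.ofFn clients)
  have hle := hS.trans_le (offlineOpt_ofFn_le_opt c clients)
  have hV : offlineCost c S (seen ([] : History F)) + ∑ i, S.inf (clients i) ≤
      ((opt c clients).toNNReal : ℝ≥0) := by
    rw [ENNReal.coe_toNNReal hfin]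
    refine le_trans (le_of_eq ?_) hle
    simp only [offlineCost, seen, List.map_nil, List.sum_nil, add_zero, List.map_ofFn,
      List.sum_ofFn, Function.comp]
  have hmain := sum_costFrom_learnOrCover_le c _ D n hD [] clients S hV
  -- The initial guess is 0, so only 4DV survives.
  have hpot : potential c D (opt c clients).toNNReal [] clients =
      4 * D * (opt c clients).toReal := by
    simp only [potential, learnState, ENNReal.coe_toNNReal_eq_toReal, NNReal.coe_zero]
    ring
  have hcost : historyCost c ([] : History F) = 0 := by simp [historyCost, openFacilities]
  rw [hpot, hcost, zero_add, ENNReal.ofReal_mul' ENNReal.toReal_nonneg,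
    ENNReal.ofReal_toReal hfin] at hmain
  exact ENNReal.div_le_of_le_mul' hmain

lemma log_bound {m n : ℕ} (hmn : 2 ≤ m * n) :
    4 * (4 * (Real.log m + 1) + 16 * Real.log (1 + n) + 3) ≤
      200 * Real.log ((m : ℝ) * (n : ℝ)) := by
  have hm : 1 ≤ m := Nat.pos_of_ne_zero fun h => by simp [h] at hmn
  have hn : 1 ≤ n := Nat.pos_of_ne_zero fun h => by simp [h] at hmn
  have hm' : (1 : ℝ) ≤ m := by exact_mod_cast hm
  have hn' : (1 : ℝ) ≤ n := by exact_mod_cast hn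
  have hmn' : (2 : ℝ) ≤ m * n := by exact_mod_cast hmn
  have h1 : Real.log m ≤ Real.log ((m : ℝ) * n) :=
    Real.log_le_log (by linarith) (le_mul_of_one_le_right (by linarith) hn')
  have h2 : Real.log 2 ≤ Real.log ((m : ℝ) * n) := Real.log_le_log two_pos hmn'
  have h3 : Real.log (1 + n) ≤ 2 * Real.log ((m : ℝ) * n) := by
    have hle : (1 + n : ℝ) ≤ ((m : ℝ) * n) ^ 2 := by
      have : (n : ℝ) ≤ m * n := le_mul_of_one_le_left (by linarith) hm'
      nlinarith
    refine (Real.log_le_log (by linarith) hle).trans_eq ?_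
    rw [Real.log_pow]
    norm_num
  have h4 := Real.log_two_gt_d9
  -- With L = log(mn) the left side is at most 16L + 128L + 28, and 28 ≤ 56 log 2 ≤ 56L.
  linarith

end Cost

end FacilityLocation

theorem mainTheorem7 :
    ∃ (C : ℝ) (A : ∀ m : ℕ, 0 < m → (Fin m → ℝ≥0) → FacilityLocation.OnlineAlgorithm (Fin m)),
      0 < C ∧
      ∀ (m : ℕ) (hm : 0 < m) (c : Fin m → ℝ≥0) (n : ℕ)
        (clients : Fin n → FacilityLocation.Client (Fin m)),
        2 ≤ m * n →
          (A m hm c).randomOrderCost c clients ≤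
            ENNReal.ofReal (C * Real.log ((m : ℝ) * (n : ℝ))) *
              FacilityLocation.opt c clients := by
  refine ⟨200, fun m hm c =>
    haveI : Nonempty (Fin m) := ⟨⟨0, hm⟩⟩
    FacilityLocation.learnOrCover c, by norm_num, fun m hm c n clients hmn => ?_⟩
  have : Nonempty (Fin m) := ⟨⟨0, hm⟩⟩
  have hlog := FacilityLocation.log_bound hmn
  -- For an infinite optimum the bound is infinite, as mn ≥ 2 makes the logarithm positive and
  -- excludes 0 · ∞.
  by_cases hfin : FacilityLocation.opt c clients = ⊤
  · have hpos : 0 < Real.log ((m : ℝ) * (n : ℝ)) :=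
      Real.log_pos (by exact_mod_cast lt_of_lt_of_le one_lt_two hmn)
    rw [hfin, ENNReal.mul_top (ENNReal.ofReal_pos.2 (by linarith)).ne']
    exact le_top
  · refine (FacilityLocation.randomOrderCost_learnOrCover_le c
      (D := 4 * (Real.log m + 1) + 16 * Real.log (1 + n) + 3)
      (by rw [Fintype.card_fin]) clients hfin).trans ?_
    gcongr
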